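/- Let $X$ be a (real) Banach space with dual $X^*$, let $c(X)$ be the family of nonempty closed convex subsets of $X$ and $cb(X)$ the family of bounded members of $c(X)$. Put $s(x^*,C)=\sup\{\langle x^*,x\rangle : x\in C\}$ and $\|C\|_h=\sup\{\|x\| : x\in C\}=d_H(C,\{0\})$, where $d_H$ is the Hausdorff distance. Let $[0,1]$ carry Lebesgue measure $\lambda$ on the $\sigma$-algebra $\mathcal L$ of Lebesgue measurable sets. Let $\Gamma:[0,1]\to cb(X)$ be a multifunction such that: 1. $\Gamma$ is Bochner measurable: there are simple multifunctions $\Gamma_n:[0,1]\to cb(X)$ (finitely many values, each taken on a set in $\mathcal L$) with $d_H(\Gamma_n(t),\Gamma(t))\to 0$ for almost every $t\in[0,1]$; 2. $\Gamma$ is Pettis integrable: $s(x^*,\Gamma(\cdot))$ is Lebesgue integrable for every $x^*\in X^*$, and for every $A\in\mathcal L$ there is a set $M_\Gamma(A)\in c(X)$ with $s(x^*,M_\Gamma(A))=\int_A s(x^*,\Gamma)\,d\lambda$ for every $x^*\in X^*$; 3. the Pettis integral has finite variation: $|M_\Gamma|([0,1])=\sup_\pi\sum_{A\in\pi}\|M_\Gamma(A)\|_h<\infty$,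 the supremum being over all finite partitions $\pi$ of $[0,1]$ into pairwise disjoint members of $\mathcal L$. Then $\Gamma$ is integrably bounded: there is $h\in L_1[0,1]$ with $\|\Gamma(t)\|_h\le|h(t)|$ for almost every $t\in[0,1]$. -/

import Mathlib

open MeasureTheory Filter
open scoped Topology ENNReal unitInterval

namespace Multifunction

/-- `c(X)`: the nonempty closed convex subsets of `X`. -/
def c (X : Type*) [NormedAddCommGroup X] [NormedSpace ℝ X] : Set (Set X) :=
  {C | C.Nonempty ∧ IsClosed C ∧ Convex ℝ C}

/-- `cb(X)`: the nonempty closed convex bounded subsets of `X`. -/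
def cb (X : Type*) [NormedAddCommGroup X] [NormedSpace ℝ X] : Set (Set X) :=
  {C | C ∈ c X ∧ Bornology.IsBounded C}

/-- The support function `s(x*, C) = sup {⟨x*, x⟩ : x ∈ C}`, with values in the extended reals. -/
noncomputable def supp {X : Type*} [NormedAddCommGroup X] [NormedSpace ℝ X]
    (f : StrongDual ℝ X) (C : Set X) : EReal :=
  ⨆ x ∈ C, ((f x : ℝ) : EReal)

/-- `‖C‖_h = sup {‖x‖ : x ∈ C}`, with values in `[0, ∞]`. -/
noncomputable def normH {X : Type*} [NormedAddCommGroup X] (C : Set X) : ℝ≥0∞ :=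
  ⨆ x ∈ C, ‖x‖ₑ

/-- `‖C‖_h` is the Hausdorff distance from `C` to `{0}`. -/
theorem normH_eq_hausdorffEDist {X : Type*} [NormedAddCommGroup X] {C : Set X}
    (hC : C.Nonempty) : normH C = Metric.hausdorffEDist C {0} := by
  obtain ⟨y, hy⟩ := hC
  simp only [normH, Metric.hausdorffEDist_def, Metric.infEDist_singleton, edist_zero_right,
    Set.mem_singleton_iff, iSup_iSup_eq_left]
  refine (max_eq_left ?_).symm
  refine (Metric.infEDist_le_edist_of_mem hy).trans ?_
  rw [edist_zero_left]
  exact le_iSup₂ (f := fun x (_ : x ∈ C) => ‖x‖ₑ) y hy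

/-- On members of `cb(X)` the support function is finite. -/
theorem coe_toReal_supp {X : Type*} [NormedAddCommGroup X] [NormedSpace ℝ X]
    (f : StrongDual ℝ X) {C : Set X} (hC : C ∈ cb X) :
    (((supp f C).toReal : ℝ) : EReal) = supp f C := by
  obtain ⟨⟨⟨y, hy⟩, -, -⟩, hb⟩ := hC
  obtain ⟨R, hR⟩ := hb.exists_norm_le
  refine EReal.coe_toReal (ne_top_of_le_ne_top (EReal.coe_ne_top (‖f‖ * R)) ?_)
    (ne_bot_of_le_ne_bot (EReal.coe_ne_bot (f y)) ?_)
  · refine iSup₂_le fun x hx => ?_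
    rw [EReal.coe_le_coe_iff]
    exact (le_abs_self _).trans ((f.le_opNorm x).trans
      (mul_le_mul_of_nonneg_left (hR x hx) (norm_nonneg f)))
  · exact le_iSup₂ (f := fun x (_ : x ∈ C) => ((f x : ℝ) : EReal)) y hy

/-- A simple multifunction: finitely many values, each taken on a Lebesgue measurable set. -/
def IsSimple {X : Type*} [NormedAddCommGroup X] [NormedSpace ℝ X] (S : I → cb X) : Prop :=
  (Set.range S).Finite ∧ ∀ C : cb X, NullMeasurableSet (S ⁻¹' {C}) volume

/-- `Γ` is the almost everywhere limit, in the Hausdorff metric, of simple multifunctions. -/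
def BochnerMeasurable {X : Type*} [NormedAddCommGroup X] [NormedSpace ℝ X]
    (Γ : I → cb X) : Prop :=
  ∃ S : ℕ → I → cb X, (∀ n, IsSimple (S n)) ∧
    ∀ᵐ t : I, Tendsto (fun n => Metric.hausdorffEDist (S n t : Set X) (Γ t : Set X)) atTop (𝓝 0)

/-- Every `s(x*, Γ(·))` is Lebesgue integrable. -/
def ScalarlyIntegrable {X : Type*} [NormedAddCommGroup X] [NormedSpace ℝ X]
    (Γ : I → cb X) : Prop :=
  ∀ f : StrongDual ℝ X, Integrable (fun t : I => (supp f (Γ t : Set X)).toReal) volume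

/-- `Γ` is Pettis integrable with indefinite Pettis integral `M`. Only the values of `M` on
Lebesgue measurable sets matter; there they are members of `c(X)`. -/
def IsPettisIntegral {X : Type*} [NormedAddCommGroup X] [NormedSpace ℝ X]
    (Γ : I → cb X) (M : Set I → Set X) : Prop :=
  ScalarlyIntegrable Γ ∧
    ∀ A : Set I, NullMeasurableSet A volume → M A ∈ c X ∧
      ∀ f : StrongDual ℝ X,
        supp f (M A) = ((∫ t in A, (supp f (Γ t : Set X)).toReal : ℝ) : EReal)

/-- The variation `|M|(E)`: the supremum of `∑ ‖M(A)‖_h` over the finite partitions of `E` into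
pairwise disjoint Lebesgue measurable sets `A`. -/
noncomputable def variation {X : Type*} [NormedAddCommGroup X]
    (M : Set I → Set X) (E : Set I) : ℝ≥0∞ :=
  ⨆ P ∈ {P : Finset (Set I) | (∀ A ∈ P, NullMeasurableSet A volume) ∧
      (P : Set (Set I)).PairwiseDisjoint id ∧ ⋃₀ (P : Set (Set I)) = E},
    ∑ A ∈ P, normH (M A)

/-- `‖Γ(t)‖_h ≤ |h(t)|` for almost all `t`, with `h` Lebesgue integrable. -/
def IntegrablyBounded {X : Type*} [NormedAddCommGroup X] [NormedSpace ℝ X]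
    (Γ : I → cb X) : Prop :=
  ∃ h : I → ℝ, Integrable h volume ∧
    ∀ᵐ t : I, normH (Γ t : Set X) ≤ ENNReal.ofReal |h t|

end Multifunction

namespace Multifunction

variable {X : Type*} [NormedAddCommGroup X]

/-! Up to a null set, Bochner measurability splits `I` into countably many measurable pieces `E k`,
on each of which `Γ` stays within Hausdorff distance 1 of a fixed `C k`. There a single functional
norming `x ∈ C k` is at least `‖x‖ - 1` on the support function of every `Γ t`, so the Pettis
integral over `E k` has norm at least `(‖C k‖_h - 1) λ(E k)` (`mul_sub_one_le_normH_integral`).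
Since `‖Γ t‖_h ≤ ‖C k‖_h + 1` there, summing bounds the integral of `(‖Γ‖_h - 2)⁺` by the variation.
The measure is finite, so the constant 2 is harmless and `h = ‖Γ‖_h` works. -/

theorem normH_lt_top {C : Set X} (hC : Bornology.IsBounded C) : normH C < ∞ := by
  obtain ⟨R, hR⟩ := hC.exists_norm_le
  refine lt_of_le_of_lt (iSup₂_le fun x hx => ?_) (ENNReal.ofReal_lt_top (r := R))
  rw [← ofReal_norm]
  exact ENNReal.ofReal_le_ofReal (hR x hx)

theorem normH_le_add_hausdorffEDist {C D : Set X} (hC : C.Nonempty) (hD : D.Nonempty) :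
    normH C ≤ normH D + Metric.hausdorffEDist D C := by
  rw [normH_eq_hausdorffEDist hC, normH_eq_hausdorffEDist hD, add_comm,
    Metric.hausdorffEDist_comm (s := D)]
  exact Metric.hausdorffEDist_triangle

/-- Adjoining the complement of the union completes a disjoint family to a partition. -/
theorem sum_normH_le_variation (M : Set I → Set X) {Q : Finset (Set I)}
    (hQ : ∀ A ∈ Q, NullMeasurableSet A volume) (hd : (Q : Set (Set I)).PairwiseDisjoint id) :
    ∑ A ∈ Q, normH (M A) ≤ variation M Set.univ := by
  classical
  set R : Set I := (⋃₀ (Q : Set (Set I)))ᶜ with hR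
  refine (Finset.sum_le_sum_of_subset (Finset.subset_insert R Q)).trans ?_
  refine le_iSup₂ (f := fun (P : Finset (Set I)) (_ : P ∈ {P : Finset (Set I) |
    (∀ A ∈ P, NullMeasurableSet A volume) ∧ (P : Set (Set I)).PairwiseDisjoint id ∧
      ⋃₀ (P : Set (Set I)) = Set.univ}) => ∑ A ∈ P, normH (M A)) (insert R Q) ⟨?_, ?_, ?_⟩
  · intro A hA
    rcases Finset.mem_insert.1 hA with rfl | hA
    · exact (NullMeasurableSet.sUnion Q.countable_toSet hQ).compl
    · exact hQ A hA
  · rw [Finset.coe_insert]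
    refine hd.insert fun A hA _ => ?_
    exact (disjoint_compl_left (a := ⋃₀ (Q : Set (Set I)))).mono_right (Set.subset_sUnion_of_mem hA)
  · rw [Finset.coe_insert, Set.sUnion_insert, hR, Set.compl_union_self]

variable [NormedSpace ℝ X]

theorem supp_le_normH {f : StrongDual ℝ X} (hf : ‖f‖ ≤ 1) (C : Set X) :
    supp f C ≤ (normH C : EReal) := by
  refine iSup₂_le fun x hx => ?_
  have h₁ : f x ≤ ‖x‖ := (le_abs_self _).trans (f.le_of_opNorm_le_of_le hf le_rfl |>.trans
    (one_mul _).le)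
  have h₂ : (((‖x‖ₑ : ℝ≥0∞)) : EReal) = ((‖x‖ : ℝ) : EReal) := by
    rw [← ofReal_norm, EReal.coe_ennreal_ofReal, max_eq_left (norm_nonneg x)]
  calc ((f x : ℝ) : EReal) ≤ ((‖x‖ : ℝ) : EReal) := EReal.coe_le_coe_iff.2 h₁
    _ = ((‖x‖ₑ : ℝ≥0∞) : EReal) := h₂.symm
    _ ≤ (normH C : EReal) := EReal.coe_ennreal_le_coe_ennreal_iff.2
      (le_iSup₂ (f := fun x (_ : x ∈ C) => ‖x‖ₑ) x hx)

theorem IsSimple.aemeasurable {S : I → cb X} (hS : IsSimple S) (G : cb X → ℝ≥0∞) :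
    AEMeasurable (fun t => G (S t)) volume := by
  refine NullMeasurable.aemeasurable fun s _ => ?_
  have : (fun t => G (S t)) ⁻¹' s = ⋃ C ∈ Set.range S ∩ G ⁻¹' s, S ⁻¹' {C} := by
    ext t
    simp only [Set.mem_preimage, Set.mem_iUnion, Set.mem_singleton_iff, exists_prop]
    exact ⟨fun h => ⟨S t, ⟨⟨t, rfl⟩, h⟩, rfl⟩, fun ⟨_, h, e⟩ => e ▸ h.2⟩
  rw [this]
  exact NullMeasurableSet.biUnion (hS.1.inter_of_left _).countable fun C _ => hS.2 C

/-- The distance to a fixed set is 1-Lipschitz for the Hausdorff distance, so it passes to the limit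
along the simple approximants. -/
theorem BochnerMeasurable.aemeasurable_hausdorffEDist {Γ : I → cb X} (hΓ : BochnerMeasurable Γ)
    {C : Set X} (hC : C.Nonempty) (hb : Bornology.IsBounded C) :
    AEMeasurable (fun t => Metric.hausdorffEDist C (Γ t : Set X)) volume := by
  obtain ⟨S, hS, hlim⟩ := hΓ
  refine aemeasurable_of_tendsto_metrizable_ae atTop
    (fun n => (hS n).aemeasurable fun D => Metric.hausdorffEDist C (D : Set X)) ?_
  filter_upwards [hlim] with t ht
  have hne : Metric.hausdorffEDist C (Γ t : Set X) ≠ ∞ :=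
    Metric.hausdorffEDist_ne_top_of_nonempty_of_bounded hC (Γ t).2.1.1 hb (Γ t).2.2
  refine tendsto_of_tendsto_of_tendsto_of_le_of_le (b := atTop)
    (g := fun n => Metric.hausdorffEDist C (Γ t : Set X)
      - Metric.hausdorffEDist (S n t : Set X) (Γ t : Set X))
    (h := fun n => Metric.hausdorffEDist C (Γ t : Set X)
      + Metric.hausdorffEDist (S n t : Set X) (Γ t : Set X)) ?_ ?_ (fun n => ?_) (fun n => ?_)
  · simpa using ENNReal.Tendsto.sub tendsto_const_nhds ht (Or.inl hne)
  · simpa using tendsto_const_nhds.add ht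
  · exact tsub_le_iff_right.2 Metric.hausdorffEDist_triangle
  · refine Metric.hausdorffEDist_triangle.trans (add_le_add le_rfl ?_)
    exact Metric.hausdorffEDist_comm.le

theorem mul_sub_one_le_normH_integral {Γ : I → cb X} {M : Set I → Set X}
    (hM : IsPettisIntegral Γ M) {A : Set I} (hA : NullMeasurableSet A volume) {x : X}
    (hx : ∀ t ∈ A, ∃ y ∈ (Γ t : Set X), edist x y < 1) :
    (‖x‖ₑ - 1) * volume A ≤ normH (M A) := by
  rcases le_total ‖x‖ₑ 1 with h | h
  -- Subtraction in `ℝ≥0∞` is truncated, so the left side vanishes.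
  · simp [tsub_eq_zero_of_le h]
  obtain ⟨f, hf, hfx⟩ := exists_dual_vector'' ℝ x
  replace hfx : f x = ‖x‖ := hfx
  have hpt : ∀ t ∈ A, ‖x‖ - 1 ≤ (supp f (Γ t : Set X)).toReal := by
    intro t ht
    obtain ⟨y, hy, hxy⟩ := hx t ht
    have h₁ : ‖x - y‖ < 1 := by
      rwa [edist_dist, dist_eq_norm, ENNReal.ofReal_lt_one] at hxy
    have h₂ : f (x - y) ≤ ‖x - y‖ := (le_abs_self _).trans
      ((f.le_of_opNorm_le_of_le hf le_rfl).trans (one_mul _).le)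
    have h₃ : f y ≤ (supp f (Γ t : Set X)).toReal := by
      rw [← EReal.coe_le_coe_iff, coe_toReal_supp f (Γ t).2]
      exact le_iSup₂ (f := fun y (_ : y ∈ (Γ t : Set X)) => ((f y : ℝ) : EReal)) y hy
    rw [map_sub] at h₂
    linarith
  have hint : (volume A).toReal * (‖x‖ - 1) ≤ ∫ t in A, (supp f (Γ t : Set X)).toReal := by
    have h₁ : ∫ _ in A, (‖x‖ - 1) = (volume A).toReal * (‖x‖ - 1) := by
      rw [setIntegral_const, smul_eq_mul, Measure.real]
    rw [← h₁]
    refine integral_mono_ae (integrable_const _) (hM.1 f).integrableOn ?_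
    filter_upwards [ae_restrict_mem₀ hA] with t ht using hpt t ht
  have hle := (EReal.coe_le_coe_iff.2 hint).trans
    (((hM.2 A hA).2 f).symm.le.trans (supp_le_normH hf (M A)))
  have hx1 : 0 ≤ ‖x‖ - 1 := by
    have : ENNReal.ofReal 1 ≤ ENNReal.ofReal ‖x‖ := by simpa using h
    linarith [(ENNReal.ofReal_le_ofReal_iff (norm_nonneg x)).1 this]
  have heq : (‖x‖ₑ - 1) * volume A = ENNReal.ofReal ((volume A).toReal * (‖x‖ - 1)) := by
    rw [ENNReal.ofReal_mul ENNReal.toReal_nonneg, ENNReal.ofReal_toReal (measure_ne_top _ _),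
      ENNReal.ofReal_sub _ zero_le_one, ofReal_norm, ENNReal.ofReal_one, mul_comm]
  rw [heq, ← EReal.coe_ennreal_le_coe_ennreal_iff, EReal.coe_ennreal_ofReal,
    max_eq_left (mul_nonneg ENNReal.toReal_nonneg hx1)]
  exact hle

/-- One unit is lost in replacing `Γ t` by `C`, another in the norming functional estimate, which is
then taken to the supremum over `x ∈ C`. -/
theorem setLIntegral_normH_sub_two_le {Γ : I → cb X} {M : Set I → Set X}
    (hM : IsPettisIntegral Γ M) {A : Set I} (hA : NullMeasurableSet A volume) (C : cb X)
    (hC : ∀ t ∈ A, Metric.hausdorffEDist (C : Set X) (Γ t : Set X) < 1) :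
    ∫⁻ t in A, (normH (Γ t : Set X) - 2) ≤ normH (M A) := by
  calc ∫⁻ t in A, (normH (Γ t : Set X) - 2)
      ≤ ∫⁻ _ in A, (normH (C : Set X) - 1) := by
        refine lintegral_mono_ae ?_
        filter_upwards [ae_restrict_mem₀ hA] with t ht
        rw [tsub_le_iff_right]
        calc normH (Γ t : Set X) ≤ normH (C : Set X) + 1 :=
              (normH_le_add_hausdorffEDist (Γ t).2.1.1 C.2.1.1).trans
                (add_le_add le_rfl (hC t ht).le)
          _ ≤ (normH (C : Set X) - 1 + 1) + 1 := add_le_add le_tsub_add le_rfl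
          _ = normH (C : Set X) - 1 + 2 := by rw [add_assoc, one_add_one_eq_two]
    _ = (normH (C : Set X) - 1) * volume A := setLIntegral_const _ _
    _ ≤ normH (M A) := by
        simp only [normH, ENNReal.iSup_sub, ENNReal.iSup_mul]
        exact iSup₂_le fun x hx => mul_sub_one_le_normH_integral hM hA fun t ht =>
          Metric.exists_edist_lt_of_hausdorffEDist_lt hx (hC t ht)

/-- The values of all the simple approximants together form a countable family. -/
theorem BochnerMeasurable.exists_countable_cover {Γ : I → cb X} (hΓ : BochnerMeasurable Γ) :
    ∃ C : ℕ → cb X, ∀ᵐ t : I, ∃ k, Metric.hausdorffEDist (C k : Set X) (Γ t : Set X) < 1 := by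
  obtain ⟨S, hS, hlim⟩ := hΓ
  have hc : (⋃ n, Set.range (S n)).Countable := Set.countable_iUnion fun n => (hS n).1.countable
  obtain ⟨C, hC⟩ := hc.exists_eq_range ⟨S 0 0, Set.mem_iUnion.2 ⟨0, 0, rfl⟩⟩
  refine ⟨C, ?_⟩
  filter_upwards [hlim] with t ht
  obtain ⟨n, hn⟩ := (ht.eventually_lt_const one_pos).exists
  have : S n t ∈ Set.range C := hC ▸ Set.mem_iUnion.2 ⟨n, t, rfl⟩
  obtain ⟨k, hk⟩ := this
  exact ⟨k, hk ▸ hn⟩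

theorem lintegral_normH_sub_two_le_variation {Γ : I → cb X} (hΓ : BochnerMeasurable Γ)
    {M : Set I → Set X} (hM : IsPettisIntegral Γ M) :
    ∫⁻ t, (normH (Γ t : Set X) - 2) ≤ variation M Set.univ := by
  classical
  obtain ⟨C, hC⟩ := hΓ.exists_countable_cover
  set F : ℕ → Set I := fun k => {t | Metric.hausdorffEDist (C k : Set X) (Γ t : Set X) < 1}
  have hF : ∀ k, NullMeasurableSet (F k) volume := fun k =>
    nullMeasurableSet_lt (hΓ.aemeasurable_hausdorffEDist (C k).2.1.1 (C k).2.2) aemeasurable_const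
  set E : ℕ → Set I := disjointed F
  have hE : ∀ k, NullMeasurableSet (E k) volume := fun k =>
    disjointedRec (fun _ _ h => h.diff (hF _)) (hF k)
  have hEd : Pairwise (Function.onFun Disjoint E) := disjoint_disjointed F
  have hU : (⋃ k, E k) =ᵐ[volume] (Set.univ : Set I) := by
    rw [iUnion_disjointed, ae_eq_univ]
    exact (measure_mono_null (fun t ht h => ht (Set.mem_iUnion.2 h)) hC)
  calc ∫⁻ t, (normH (Γ t : Set X) - 2)
      = ∫⁻ t in ⋃ k, E k, (normH (Γ t : Set X) - 2) := by
        rw [setLIntegral_congr hU, setLIntegral_univ]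
    _ = ∑' k, ∫⁻ t in E k, (normH (Γ t : Set X) - 2) :=
        lintegral_iUnion₀ hE (hEd.mono fun _ _ h => h.aedisjoint) _
    _ ≤ variation M Set.univ := ENNReal.tsum_le_of_sum_range_le fun N => ?_
  -- The variation sums over sets, not indices. Disjoint pieces can coincide only when empty, and
  -- those contribute zero.
  rw [← Finset.sum_image_of_pairwise_eq_zero (f := E)
    (g := fun A => ∫⁻ t in A, (normH (Γ t : Set X) - 2))]
  · refine (Finset.sum_le_sum fun A hA => ?_).trans
      (sum_normH_le_variation M (Q := (Finset.range N).image E) ?_ ?_)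
    · obtain ⟨k, -, rfl⟩ := Finset.mem_image.1 hA
      exact setLIntegral_normH_sub_two_le hM (hE k) (C k) fun t ht => disjointed_subset F k ht
    · intro A hA
      obtain ⟨k, -, rfl⟩ := Finset.mem_image.1 hA
      exact hE k
    · intro A hA B hB hAB
      obtain ⟨i, -, rfl⟩ := Finset.mem_image.1 hA
      obtain ⟨j, -, rfl⟩ := Finset.mem_image.1 hB
      exact hEd fun h => hAB (congrArg E h)
  · intro i _ j _ hij h
    have : E i = ∅ := by
      have := hEd hij
      rw [Function.onFun, ← h] at this
      exact disjoint_self.1 this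
    simp [this]

end Multifunction

theorem mainTheorem3 {X : Type*} [NormedAddCommGroup X] [NormedSpace ℝ X] [CompleteSpace X]
    (Γ : I → Multifunction.cb X) (hΓ : Multifunction.BochnerMeasurable Γ)
    (M : Set I → Set X) (hM : Multifunction.IsPettisIntegral Γ M)
    (hvar : Multifunction.variation M Set.univ < ∞) :
    Multifunction.IntegrablyBounded Γ := by
  have hmeas : AEMeasurable (fun t => Multifunction.normH (Γ t : Set X)) volume := by
    -- `‖Γ t‖_h` is the distance to the fixed set `{0}`.
    refine (hΓ.aemeasurable_hausdorffEDist (Set.singleton_nonempty 0)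
      Bornology.isBounded_singleton).congr (ae_of_all _ fun t => ?_)
    simp only
    rw [Metric.hausdorffEDist_comm, Multifunction.normH_eq_hausdorffEDist (Γ t).2.1.1]
  have hfin : ∫⁻ t, Multifunction.normH (Γ t : Set X) ≠ ∞ := by
    refine ne_top_of_le_ne_top (b := Multifunction.variation M Set.univ + 2)
      (ENNReal.add_ne_top.2 ⟨hvar.ne, ENNReal.ofNat_ne_top⟩) ?_
    calc ∫⁻ t, Multifunction.normH (Γ t : Set X)
        ≤ ∫⁻ t, (Multifunction.normH (Γ t : Set X) - 2 + 2) :=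
          lintegral_mono fun t => le_tsub_add
      _ = (∫⁻ t, (Multifunction.normH (Γ t : Set X) - 2)) + 2 := by
          rw [lintegral_add_right _ measurable_const, lintegral_const, measure_univ, mul_one]
      _ ≤ Multifunction.variation M Set.univ + 2 :=
          add_le_add (Multifunction.lintegral_normH_sub_two_le_variation hΓ hM) le_rfl
  refine ⟨fun t => (Multifunction.normH (Γ t : Set X)).toReal,
    integrable_toReal_of_lintegral_ne_top hmeas hfin, ae_of_all _ fun t => ?_⟩
  rw [abs_of_nonneg ENNReal.toReal_nonneg,
    ENNReal.ofReal_toReal (Multifunction.normH_lt_top (Γ t).2.2).ne]
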